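/- Fix $T>0$ and a sequence $\mathcal T=(\tau_n)_{n\ge 0}$ of finite partitions $\tau_n=\{0=t_{n,0}<\dots<t_{n,K(n)}=T\}$ of $[0,T]$ whose mesh tends to $0$. Let $\mathcal Z_{\mathcal T}([0,T])$ be the set of continuous functions $z:[0,T]\to\mathbb R$ with $z(0)=0$ and quadratic variation $[z]^{\mathcal T}_t=t$ for $0\le t\le T$ along $\mathcal T$, i.e. the discrete measures $\sum_{k<K(n)}(z(t_{n,k+1})-z(t_{n,k}))^2\,\delta_{t_{n,k}}$ converge weakly, as $n\to\infty$, to an atomless finite measure $\xi$ on $[0,T]$ with $\xi([0,t])=t$ for all $t\in[0,T]$. Let $\mathcal N([0,T])$ be the set of functions $n(t)=\#\{i:s_i\le t\}$ with $m\ge 0$ and $0<s_1<\dots<s_m<T$. Fix $\sigma>0$, $x_0>0$ and a non-empty set $C\subset\mathbb R$ with $\inf C>-1$, and let $\mathcal J^{\sigma,C}_\tau(x_0)$ be the set of functions $$x(t)=x_0e^{\sigma z(t)}\prod_{i=1}^{n(t)}(1+a_i),\qquad t\in[0,T],$$ with $z\in\mathcal Z_{\mathcal T}([0,T])$, $n\in\mathcal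 N([0,T])$ having $m$ jumps, and $a_1,\dots,a_m\in C$. For real functions $x,y$ on $[0,T]$ let $d_s(x,y)$ be the Skorohod distance, the infimum, over all increasing bijections $\rho$ of $[0,T]$ onto itself, of $\max\{\sup_t|\rho(t)-t|,\ \sup_t|x(t)-y(\rho(t))|\}$. Proposition. On a probability space $(\Omega,\mathcal F,P)$ let $W$ be a standard Brownian motion, $N$ a homogeneous Poisson process with intensity $\lambda>0$, and $X_1,X_2,\dots$ independent real random variables with common distribution function $F_X$, such that $W$, $N$ and the sequence $(X_i)_{i\ge1}$ are mutually independent. Let $\mu\in\mathbb R$ and $$Z_t=x_0\,e^{(\mu-\frac12\sigma^2)t+\sigma W_t}\prod_{i=1}^{N_t}(1+X_i),\qquad t\in[0,T].$$ Assume that $F_X(a+\epsilon)-F_X(a-\epsilon)>0$ for all $a\in C$ and all $\epsilon>0$. Then $Z$ satisfies the small ball property on $\mathcal J^{\sigma,C}_\tau(x_0)$ with respect to the Skorohod distance: for every $x\in\mathcal J^{\sigma,C}_\tau(x_0)$ and every $\epsilon>0$, the set $\{d_s(Z,x)<\epsilon\}$ is an event (measurable with respect to the $P$-completion of $\mathcal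 F$) and $P(d_s(Z,x)<\epsilon)>0$. -/

import Mathlib

open MeasureTheory ProbabilityTheory Filter Topology
open scoped NNReal ENNReal

noncomputable section

/-- The time interval `[0, T]`. -/
abbrev TimeInterval (T : ℝ≥0) : Type := Set.Icc (0 : ℝ≥0) T

/-- A sequence `𝒯 = (τ_n)` of finite partitions `0 = t_{n,0} < ⋯ < t_{n,K(n)} = T` of `[0, T]`
whose mesh tends to `0`. -/
structure PartitionSeq (T : ℝ≥0) where
  /-- The number of intervals of the `n`-th partition. -/
  K : ℕ → ℕ
  /-- The points of the `n`-th partition. -/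
  point : (n : ℕ) → Fin (K n + 1) → TimeInterval T
  strictMono_point : ∀ n, StrictMono (point n)
  point_zero : ∀ n, (point n 0 : ℝ≥0) = 0
  point_last : ∀ n, (point n (Fin.last (K n)) : ℝ≥0) = T
  mesh_tendsto : Tendsto
    (fun n => ⨆ k : Fin (K n), ((point n k.succ : ℝ) - (point n k.castSucc : ℝ))) atTop (𝓝 0)

/-- For a *continuous* path `x` on `[0, T]`: the discrete measures
`ξ_n = ∑_{t_i ∈ τ_n} (x(t_{i+1}) - x(t_i))² δ_{t_i}` converge weakly to the finite measure `ξ` on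
`[0, T]`, and `ξ` has no atoms (its atoms have to be the squared jumps of `x`). -/
structure HasQuadraticVariationMeasure {T : ℝ≥0} (𝒯 : PartitionSeq T) (x : TimeInterval T → ℝ)
    (ξ : Measure (TimeInterval T)) : Prop where
  isFiniteMeasure : IsFiniteMeasure ξ
  tendsto_integral : ∀ f : C(TimeInterval T, ℝ), Tendsto
    (fun n => ∑ k : Fin (𝒯.K n),
      (x (𝒯.point n k.succ) - x (𝒯.point n k.castSucc)) ^ 2 * f (𝒯.point n k.castSucc))
    atTop (𝓝 (∫ t, f t ∂ξ))
  noAtoms : ∀ t, ξ {t} = 0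

/-- The class `𝒵_𝒯([0, T])` of continuous functions `z` on `[0, T]` with `z(0) = 0` and quadratic
variation `[z]_t = t` along `𝒯`; `[z]` is the distribution function of the limit measure. -/
def BrownianLikePaths {T : ℝ≥0} (𝒯 : PartitionSeq T) : Set (TimeInterval T → ℝ) :=
  {z | Continuous z ∧ (∀ t : TimeInterval T, (t : ℝ≥0) = 0 → z t = 0) ∧
    ∃ ξ : Measure (TimeInterval T), HasQuadraticVariationMeasure 𝒯 z ξ ∧
      ∀ t : TimeInterval T, ξ (Set.Iic t) = ((t : ℝ≥0) : ℝ≥0∞)}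

/-- `n` is a counting path on `[0, T]` with `m` jumps: there are `0 < s_1 < ⋯ < s_m < T` such that
`n(t)` is the number of `i` with `s_i ≤ t`. -/
def IsCountingPath {T : ℝ≥0} (m : ℕ) (n : TimeInterval T → ℕ) : Prop :=
  ∃ s : Fin m → ℝ≥0, StrictMono s ∧ (∀ i, 0 < s i ∧ s i < T) ∧
    ∀ t : TimeInterval T, n t = (Finset.univ.filter fun i => s i ≤ (t : ℝ≥0)).card

/-- The trajectory class `𝒥_τ^{σ,C}(x₀)`: functions `x₀ e^{σ z(t)} ∏_{i=1}^{n(t)} (1 + a_i)` with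
`z ∈ 𝒵_𝒯([0, T])`, `n` a counting path with `m` jumps and `a_1, …, a_m ∈ C`
(here indexed from `0`). -/
def JumpDiffusionPaths {T : ℝ≥0} (𝒯 : PartitionSeq T) (σ : ℝ) (C : Set ℝ) (x₀ : ℝ) :
    Set (TimeInterval T → ℝ) :=
  {x | ∃ z ∈ BrownianLikePaths 𝒯, ∃ (m : ℕ) (n : TimeInterval T → ℕ) (a : ℕ → ℝ),
    IsCountingPath m n ∧ (∀ i < m, a i ∈ C) ∧
    ∀ t, x t = x₀ * Real.exp (σ * z t) * ∏ i ∈ Finset.range (n t), (1 + a i)}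

/-- The Skorohod distance: the infimum over the increasing bijections `ρ` of `[0, T]` onto itself
of `max (sup_t |ρ(t) - t|) (sup_t |x(t) - y(ρ(t))|)`. It is finite on RCLL paths; the value `∞`
can occur only for other functions. -/
def skorohodDist {T : ℝ≥0} (x y : TimeInterval T → ℝ) : ℝ≥0∞ :=
  ⨅ ρ : TimeInterval T ≃o TimeInterval T,
    max (⨆ t, edist (ρ t) t) (⨆ t, edist (x t) (y (ρ t)))

/-- `Z` has the small ball property with respect to the distance `d` and the set of paths `J`:
for all `x ∈ J` and `ε > 0`, `{d(Z, x) < ε}` is an event (of the `P`-completed σ-algebra) of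
positive probability. -/
def SmallBallProperty {Ω E : Type*} [MeasurableSpace Ω] (P : Measure Ω) (d : E → E → ℝ≥0∞)
    (Z : Ω → E) (J : Set E) : Prop :=
  ∀ x ∈ J, ∀ ε : ℝ, 0 < ε →
    NullMeasurableSet {ω | d (Z ω) x < ENNReal.ofReal ε} P ∧
      0 < P {ω | d (Z ω) x < ENNReal.ofReal ε}

/-- `N` is a homogeneous Poisson process with intensity `lam`: it starts at `0`, has independent
increments, `N_{s+h} - N_s` is Poisson distributed with parameter `lam * h`, and almost all paths
are nondecreasing and right continuous (so the subtraction of natural numbers is a.s. the true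
one). -/
structure IsPoissonProcess {Ω : Type*} [MeasurableSpace Ω] (N : ℝ≥0 → Ω → ℕ) (lam : ℝ≥0)
    (P : Measure Ω) : Prop where
  zero : ∀ᵐ ω ∂P, N 0 ω = 0
  indep_increments : HasIndepIncrements N P
  law_increments : ∀ s h : ℝ≥0,
    HasLaw (fun ω => N (s + h) ω - N s ω) (poissonMeasure (lam * h)) P
  paths : ∀ᵐ ω ∂P, Monotone (fun t => N t ω) ∧
    ∀ t, ContinuousWithinAt (fun u => N u ω) (Set.Ici t) t

/-- The exponential jump-diffusion
`Z_t = x₀ e^{(μ - σ²/2) t + σ W_t} ∏_{i=1}^{N_t} (1 + X_i)` on `[0, T]`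
(the `X_i` are indexed from `0`). -/
def expJumpDiffusion {Ω : Type*} (T : ℝ≥0) (x₀ μ σ : ℝ) (W : ℝ≥0 → Ω → ℝ) (N : ℝ≥0 → Ω → ℕ)
    (X : ℕ → Ω → ℝ) (ω : Ω) (t : TimeInterval T) : ℝ :=
  x₀ * Real.exp ((μ - σ ^ 2 / 2) * (t : ℝ) + σ * W t ω) *
    ∏ i ∈ Finset.range (N t ω), (1 + X i ω)

end

/-! Positivity. Write `g t = z t - (μ - σ²/2) t / σ`. If `W` is uniformly close to `g` on `[0, T]`,
the continuous factor of `Z` is uniformly close to that of the reference path. If `N` has the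
reference increments over every cell of a fine grid, its jump times are within one mesh of the
reference ones, so a time change near the identity carries one counting path exactly onto the other.
If also the first `m` jump sizes are close to the `a i`, the paths are Skorohod close
(`exists_forall_skorohodDist_le`). The three conditions concern independent objects, so it is enough
that each has positive probability. For `N` and `X` this is a finite product of positive numbers.

For `W` (`measure_brownian_close_pos`), the deviation of `W` from its linear interpolation along a
grid is independent of the grid values. By path continuity the deviation is small with positive
probability once the grid is fine. The grid values are close to those of `g` with positive
probability, because the increments are independent nondegenerate Gaussians.

Measurability. The Skorohod distance is an infimum over uncountably many time changes. Along paths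
constant on the cells of a grid it is a 1-Lipschitz function of finitely many values, hence
measurable. Almost every path of `Z` is the Skorohod limit of its grid discretizations
(`tendsto_skorohodDist_gridApprox`), and the triangle inequality passes measurability to the limit.
-/

/-! ### The Skorohod distance as an extended pseudometric -/

section Skorohod

variable {T : ℝ≥0}

lemma skorohodDist_le {x y : TimeInterval T → ℝ} (ρ : TimeInterval T ≃o TimeInterval T) {r : ℝ}
    (hρ : ∀ t, |((ρ t : ℝ≥0) : ℝ) - t| ≤ r) (hxy : ∀ t, |x t - y (ρ t)| ≤ r) :
    skorohodDist x y ≤ ENNReal.ofReal r := by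
  refine (iInf_le _ ρ).trans (max_le (iSup_le fun t => ?_) (iSup_le fun t => ?_))
  · rw [edist_dist]
    exact ENNReal.ofReal_le_ofReal (hρ t)
  · rw [edist_dist]
    exact ENNReal.ofReal_le_ofReal (hxy t)

lemma skorohodDist_comm_le (x y : TimeInterval T → ℝ) : skorohodDist x y ≤ skorohodDist y x := by
  refine le_iInf fun ρ => (iInf_le _ ρ.symm).trans (max_le_max ?_ ?_)
  · refine iSup_le fun t => le_iSup_of_le (ρ.symm t) ?_
    simp [edist_comm]
  · refine iSup_le fun t => le_iSup_of_le (ρ.symm t) ?_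
    simp [edist_comm]

lemma skorohodDist_comm (x y : TimeInterval T → ℝ) : skorohodDist x y = skorohodDist y x :=
  le_antisymm (skorohodDist_comm_le x y) (skorohodDist_comm_le y x)

lemma skorohodDist_triangle (x y z : TimeInterval T → ℝ) :
    skorohodDist x z ≤ skorohodDist x y + skorohodDist y z := by
  refine ENNReal.le_iInf_add_iInf fun ρ ρ' => (iInf_le _ (ρ.trans ρ')).trans (max_le ?_ ?_)
  · refine iSup_le fun t => ?_
    calc edist ((ρ.trans ρ') t) t ≤ edist (ρ t) t + edist (ρ' (ρ t)) (ρ t) := by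
          rw [add_comm]; exact edist_triangle _ _ _
      _ ≤ _ := add_le_add (le_max_of_le_left (le_iSup (fun t => edist (ρ t) t) t))
          (le_max_of_le_left (le_iSup (fun t => edist (ρ' t) t) (ρ t)))
  · refine iSup_le fun t => ?_
    calc edist (x t) (z ((ρ.trans ρ') t)) ≤ edist (x t) (y (ρ t)) + edist (y (ρ t)) (z (ρ' (ρ t))) :=
          edist_triangle _ _ _
      _ ≤ _ := add_le_add (le_max_of_le_right (le_iSup (fun t => edist (x t) (y (ρ t))) t))
          (le_max_of_le_right (le_iSup (fun t => edist (y t) (z (ρ' t))) (ρ t)))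

lemma skorohodDist_le_iSup_edist (x y : TimeInterval T → ℝ) :
    skorohodDist x y ≤ ⨆ t, edist (x t) (y t) := by
  refine (iInf_le _ (OrderIso.refl _)).trans (max_le ?_ le_rfl)
  simp

end Skorohod

/-! ### Time changes moving finitely many points -/

section TimeChange

lemma eventually_pos_le {c : ℝ} (hc : 0 < c) : ∀ᶠ w in 𝓝[>] (0 : ℝ), w ≤ c :=
  eventually_nhdsWithin_of_eventually_nhds (eventually_le_nhds hc)

lemma exists_pos_separation {T : ℝ} (S : Finset ℝ) (hS : ∀ p ∈ S, 0 < p ∧ p < T) :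
    ∃ w > 0, ∀ p ∈ S, w ≤ p ∧ w ≤ T - p ∧ ∀ p' ∈ S, p' ≠ p → w ≤ |p - p'| := by
  have h : ∀ᶠ w in 𝓝[>] (0 : ℝ), ∀ p ∈ S, w ≤ p ∧ w ≤ T - p ∧ ∀ p' ∈ S, p' ≠ p → w ≤ |p - p'| := by
    refine (Filter.eventually_all_finset S).2 fun p hp => ?_
    refine (eventually_pos_le (hS p hp).1).and ((eventually_pos_le (sub_pos.2 (hS p hp).2)).and ?_)
    refine (Filter.eventually_all_finset S).2 fun p' _ => ?_
    by_cases h : p' = p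
    · simp [h]
    · filter_upwards [eventually_pos_le (abs_pos.2 (sub_ne_zero.2 (Ne.symm h)))] with w hw _ using hw
  obtain ⟨w, hw, hw0⟩ := (h.and self_mem_nhdsWithin).exists
  exact ⟨w, hw0, hw⟩

/-- The tent function of width `w` and height `1` centred at `p`. -/
noncomputable def tent (w p t : ℝ) : ℝ := max 0 (1 - |t - p| / w)

lemma continuous_tent (w p : ℝ) : Continuous (tent w p) := by
  unfold tent
  fun_prop

lemma tent_self (w p : ℝ) : tent w p p = 1 := by simp [tent]

lemma tent_eq_zero {w p t : ℝ} (hw : 0 < w) (h : w ≤ |t - p|) : tent w p t = 0 := by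
  refine max_eq_left ?_
  have := (one_le_div hw).2 h
  linarith

lemma abs_tent_le {w : ℝ} (hw : 0 < w) (p t : ℝ) : |tent w p t| ≤ 1 := by
  have : 0 ≤ |t - p| / w := by positivity
  rw [tent, abs_of_nonneg (le_max_left _ _)]
  exact max_le zero_le_one (by linarith)

lemma abs_tent_sub_le {w : ℝ} (hw : 0 < w) (p s t : ℝ) :
    |tent w p t - tent w p s| ≤ |t - s| / w := by
  unfold tent
  rw [max_comm 0, max_comm 0]
  refine (abs_max_sub_max_le_abs _ _ _).trans ?_
  have h1 : (1 - |t - p| / w) - (1 - |s - p| / w) = (|s - p| - |t - p|) / w := by ring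
  have h2 : |(|s - p| - |t - p|)| ≤ |t - s| := by
    have := abs_abs_sub_abs_le_abs_sub (s - p) (t - p)
    rwa [sub_sub_sub_cancel_right, abs_sub_comm s t] at this
  rw [h1, abs_div, abs_of_pos hw]
  gcongr

/-- A continuous strictly increasing real function fixing `0` and `T` restricts to an increasing
bijection of `[0, T]`. -/
lemma exists_orderIso_of_strictMono {T : ℝ≥0} {f : ℝ → ℝ} (hf : StrictMono f) (hc : Continuous f)
    (h0 : f 0 = 0) (hT : f T = T) :
    ∃ ρ : TimeInterval T ≃o TimeInterval T, ∀ t, ((ρ t : ℝ≥0) : ℝ) = f t := by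
  have hn (t : TimeInterval T) : 0 ≤ f t := h0 ▸ hf.monotone t.1.2
  have hle (t : TimeInterval T) : f t ≤ T := hT ▸ hf.monotone t.2.2
  let g : TimeInterval T → TimeInterval T := fun t => ⟨⟨f t, hn t⟩, zero_le, hle t⟩
  have hg : StrictMono g := fun s t hst => hf (show ((s : ℝ≥0) : ℝ) < t from hst)
  have hsurj : Function.Surjective g := by
    intro y
    obtain ⟨x, hx, hxy⟩ := intermediate_value_Icc (T.2) hc.continuousOn
      (show ((y : ℝ≥0) : ℝ) ∈ Set.Icc (f 0) (f T) from by
        rw [h0, hT]; exact ⟨y.1.2, y.2.2⟩)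
    exact ⟨⟨⟨x, hx.1⟩, zero_le, hx.2⟩, Subtype.ext (Subtype.ext hxy)⟩
  exact ⟨hg.orderIsoOfSurjective g hsurj, fun t => rfl⟩

/-- Finitely many interior points of `[0, T]` can be moved to nearby positions by an increasing
bijection close to the identity. -/
lemma exists_orderIso_map_eq {T : ℝ≥0} (S : Finset ℝ) (hS : ∀ p ∈ S, 0 < p ∧ p < T)
    {η : ℝ} (hη : 0 < η) :
    ∃ δ > 0, ∀ q : ℝ → ℝ, (∀ p ∈ S, |q p - p| ≤ δ) →
      ∃ ρ : TimeInterval T ≃o TimeInterval T,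
        (∀ t : TimeInterval T, ((t : ℝ≥0) : ℝ) ∈ S → ((ρ t : ℝ≥0) : ℝ) = q t) ∧
        ∀ t, |((ρ t : ℝ≥0) : ℝ) - t| ≤ η := by
  obtain ⟨w, hw, hwS⟩ := exists_pos_separation S hS
  set c : ℝ := S.card + 1 with hcdef
  have hc : 0 < c := by positivity
  -- This makes `S.card * δ ≤ min η (w / 2)`. The bound `η` controls the displacement; the bound `w
  -- / 2` makes the sum of tents `1/2`-Lipschitz, so that adding it to the identity stays strictly
  -- increasing.
  refine ⟨min η (w / 2) / c, by positivity, fun q hq => ?_⟩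
  set δ := min η (w / 2) / c with hδ
  have hδ0 : 0 < δ := by positivity
  have hcδ : S.card * δ ≤ min η (w / 2) := by
    have : c * δ = min η (w / 2) := by rw [hδ]; field_simp
    nlinarith
  have hcη := hcδ.trans (min_le_left _ _)
  have hcw := hcδ.trans (min_le_right _ _)
  let f : ℝ → ℝ := fun t => t + ∑ p ∈ S, (q p - p) * tent w p t
  have hf : StrictMono f := by
    intro s t hst
    have h1 : |∑ p ∈ S, (q p - p) * tent w p t - ∑ p ∈ S, (q p - p) * tent w p s|
        ≤ S.card * (δ * ((t - s) / w)) := by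
      rw [← Finset.sum_sub_distrib, ← nsmul_eq_mul]
      refine (Finset.abs_sum_le_sum_abs _ _).trans (Finset.sum_le_card_nsmul _ _ _ fun p hp => ?_)
      rw [← mul_sub, abs_mul]
      have := abs_tent_sub_le hw p s t
      rw [abs_of_pos (sub_pos.2 hst)] at this
      exact mul_le_mul (hq p hp) this (abs_nonneg _) hδ0.le
    have h2 : S.card * (δ * ((t - s) / w)) ≤ (t - s) / 2 := by
      calc S.card * (δ * ((t - s) / w)) = (S.card * δ) * ((t - s) / w) := by ring
        _ ≤ (w / 2) * ((t - s) / w) := by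
          have : 0 ≤ (t - s) / w := div_nonneg (sub_pos.2 hst).le hw.le
          gcongr
        _ = (t - s) / 2 := by field_simp
    have h3 := (abs_le.1 h1).1
    have : f t - f s = (t - s) + (∑ p ∈ S, (q p - p) * tent w p t
      - ∑ p ∈ S, (q p - p) * tent w p s) := by simp only [f]; ring
    linarith
  have hcont : Continuous f := by
    refine continuous_id.add (continuous_finsetSum _ fun p _ => ?_)
    exact continuous_const.mul (continuous_tent w p)
  have h0 : f 0 = 0 := by
    simp only [f, zero_add]
    refine Finset.sum_eq_zero fun p hp => ?_
    rw [tent_eq_zero hw, mul_zero]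
    rw [zero_sub, abs_neg]
    exact (hwS p hp).1.trans (le_abs_self _)
  have hT : f T = T := by
    simp only [f, add_eq_left]
    refine Finset.sum_eq_zero fun p hp => ?_
    rw [tent_eq_zero hw, mul_zero]
    exact (hwS p hp).2.1.trans (le_abs_self _)
  obtain ⟨ρ, hρ⟩ := exists_orderIso_of_strictMono hf hcont h0 hT
  refine ⟨ρ, fun t ht => ?_, fun t => ?_⟩
  · rw [hρ]
    simp only [f]
    rw [Finset.sum_eq_single_of_mem _ ht, tent_self]
    · ring
    · intro p hp hpt
      rw [tent_eq_zero hw, mul_zero]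
      exact (hwS _ ht).2.2 p hp hpt
  · rw [hρ]
    simp only [f, add_sub_cancel_left]
    refine ((Finset.abs_sum_le_sum_abs _ _).trans
      (Finset.sum_le_card_nsmul _ _ δ fun p hp => ?_)).trans (by rwa [nsmul_eq_mul])
    rw [abs_mul]
    exact (mul_le_mul (hq p hp) (abs_tent_le hw p t) (abs_nonneg _) hδ0.le).trans_eq (mul_one _)

end TimeChange

/-- The superlevel sets of a nondecreasing right-continuous counting function are closed
half-lines. -/
lemma exists_forall_le_iff_le {f : ℝ≥0 → ℕ} (hf : Monotone f)
    (hc : ∀ t, ContinuousWithinAt f (Set.Ici t) t) {k : ℕ} {T : ℝ≥0} (hk : k ≤ f T) :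
    ∃ r, ∀ t, k ≤ f t ↔ r ≤ t := by
  have hne : {t | k ≤ f t}.Nonempty := ⟨T, hk⟩
  set r := sInf {t | k ≤ f t} with hr
  have hkr : k ≤ f r := by
    by_contra! hlt
    -- Since `ℕ` is discrete, right continuity makes `f` constant immediately to the right of `r`,
    -- where the superlevel set has points.
    have h : ∀ᶠ u in 𝓝[≥] r, f u = f r := hc r (show {m | m = f r} ∈ 𝓝 (f r) by simp)
    obtain ⟨b, hb, hsub⟩ := (mem_nhdsGE_iff_exists_Ico_subset).1 h
    obtain ⟨t, ht, htb⟩ := exists_lt_of_csInf_lt hne (show sInf {t | k ≤ f t} < b from hb)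
    have hrt : r ≤ t := csInf_le (OrderBot.bddBelow _) ht
    have h1 : f t = f r := hsub ⟨hrt, htb⟩
    have h2 : k ≤ f t := ht
    omega
  exact ⟨r, fun t => ⟨fun h => csInf_le (OrderBot.bddBelow _) h, fun h => hkr.trans (hf h)⟩⟩

/-! ### Discretization along grids and measurability of the Skorohod distance -/

section GridApproximation

variable {T : ℝ≥0}

/-- The index of the cell of the grid `{k T / (n + 1)}` containing `t`. -/
noncomputable def gridIndex (n : ℕ) (t : TimeInterval T) : ℕ := ⌊((t : ℝ≥0) : ℝ) * (n + 1) / T⌋₊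

lemma gridIndex_lt (n : ℕ) (t : TimeInterval T) : gridIndex n t < n + 2 := by
  have h : ((t : ℝ≥0) : ℝ) * (n + 1) / T ≤ n + 1 := by
    refine div_le_of_le_mul₀ T.2 (by positivity) ?_
    rw [mul_comm]
    exact mul_le_mul_of_nonneg_left t.2.2 (by positivity)
  have : gridIndex n t ≤ n + 1 := Nat.floor_le_of_le (by exact_mod_cast h)
  omega

/-- The `k`-th point of the grid `{k T / (n + 1)}`, truncated at `T`. -/
noncomputable def gridPoint (T : ℝ≥0) (n k : ℕ) : TimeInterval T :=
  ⟨min (k * T / (n + 1)) T, zero_le, min_le_right _ _⟩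

lemma gridPoint_of_le {n k : ℕ} (hk : k ≤ n + 1) :
    ((gridPoint T n k : ℝ≥0) : ℝ) = k * T / (n + 1) := by
  have h : (k * T / (n + 1) : ℝ≥0) ≤ T := by
    refine div_le_of_le_mul₀ zero_le zero_le ?_
    rw [mul_comm]
    gcongr
    exact_mod_cast hk
  simp [gridPoint, min_eq_left h]

/-- The path that is constant on the cells of the grid and agrees with `x` at the left ends. -/
noncomputable def gridApprox (n : ℕ) (x : TimeInterval T → ℝ) (t : TimeInterval T) : ℝ :=
  x (gridPoint T n (gridIndex n t))

/-- Changing the finitely many values changes the distance by at most their sup-distance. This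
Lipschitz bound avoids handling the uncountable infimum directly. -/
lemma measurable_skorohodDist_step (n : ℕ) (x : TimeInterval T → ℝ) :
    Measurable fun v : Fin (n + 2) → ℝ =>
      skorohodDist (fun t => v ⟨gridIndex n t, gridIndex_lt n t⟩) x := by
  refine (continuous_of_le_add_edist 1 ENNReal.one_ne_top fun v v' => ?_).measurable
  rw [one_mul, add_comm (skorohodDist _ _)]
  refine (skorohodDist_triangle _ _ _).trans (add_le_add_left ?_ _)
  exact (skorohodDist_le_iSup_edist _ _).trans (iSup_le fun t => edist_le_pi_edist v v' _)

lemma aemeasurable_skorohodDist_gridApprox {Ω : Type*} [MeasurableSpace Ω] {P : Measure Ω}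
    {Z : Ω → TimeInterval T → ℝ} (hZ : ∀ t, AEMeasurable (fun ω => Z ω t) P) (n : ℕ)
    (x : TimeInterval T → ℝ) :
    AEMeasurable (fun ω => skorohodDist (gridApprox n (Z ω)) x) P :=
  (measurable_skorohodDist_step n x).comp_aemeasurable
    (f := fun ω (k : Fin (n + 2)) => Z ω (gridPoint T n k)) (aemeasurable_pi_lambda _ fun _ => hZ _)

/-- The Skorohod distance to a fixed path is measurable along a process that is approximated by
its discretizations. -/
lemma aemeasurable_skorohodDist {Ω : Type*} [MeasurableSpace Ω] {P : Measure Ω}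
    {Z : Ω → TimeInterval T → ℝ} (hZ : ∀ t, AEMeasurable (fun ω => Z ω t) P)
    (hlim : ∀ᵐ ω ∂P, Tendsto (fun n => skorohodDist (Z ω) (gridApprox n (Z ω))) atTop (𝓝 0))
    (x : TimeInterval T → ℝ) :
    AEMeasurable (fun ω => skorohodDist (Z ω) x) P := by
  refine aemeasurable_of_tendsto_metrizable_ae atTop
    (fun n => aemeasurable_skorohodDist_gridApprox hZ n x) ?_
  filter_upwards [hlim] with ω hω
  -- The triangle inequality squeezes the distance of the discretization to `x` between the distance
  -- of `Z ω` to `x` minus and plus the discretization error.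
  have hlow := ENNReal.Tendsto.sub (tendsto_const_nhds (x := skorohodDist (Z ω) x)) hω
    (Or.inr ENNReal.zero_ne_top)
  have hup := hω.add (tendsto_const_nhds (x := skorohodDist (Z ω) x))
  rw [tsub_zero] at hlow
  rw [zero_add] at hup
  refine tendsto_of_tendsto_of_tendsto_of_le_of_le hlow hup (fun n => ?_) (fun n => ?_)
  · exact tsub_le_iff_left.2 (skorohodDist_triangle _ _ _)
  · refine (skorohodDist_triangle _ (Z ω) _).trans ?_
    rw [skorohodDist_comm]

lemma gridPoint_gridIndex (n : ℕ) (t : TimeInterval T) :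
    ((gridPoint T n (gridIndex n t) : ℝ≥0) : ℝ) = gridIndex n t * T / (n + 1) :=
  gridPoint_of_le (Nat.lt_succ_iff.1 (gridIndex_lt n t))

lemma abs_gridPoint_gridIndex_sub_le (hT : 0 < T) (n : ℕ) (t : TimeInterval T) :
    |((gridPoint T n (gridIndex n t) : ℝ≥0) : ℝ) - t| ≤ T / (n + 1) := by
  have hT' : (0 : ℝ) < T := hT
  have hn : (0 : ℝ) < n + 1 := by positivity
  have h0 : (0 : ℝ) ≤ ((t : ℝ≥0) : ℝ) * (n + 1) / T := by positivity
  rw [gridPoint_gridIndex]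
  have h1 : (gridIndex n t : ℝ) ≤ ((t : ℝ≥0) : ℝ) * (n + 1) / T := Nat.floor_le h0
  have h2 : ((t : ℝ≥0) : ℝ) * (n + 1) / T < gridIndex n t + 1 := Nat.lt_floor_add_one _
  rw [le_div_iff₀ hT'] at h1
  rw [div_lt_iff₀ hT'] at h2
  rw [abs_le]
  constructor
  · rw [neg_le_sub_iff_le_add, ← add_div, le_div_iff₀ hn]
    linarith
  · rw [sub_le_iff_le_add, div_le_iff₀ hn, add_mul, div_mul_cancel₀ _ hn.ne']
    linarith

/-- The smallest point of the grid `{k T / (n + 1)}` above `r`. -/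
noncomputable def gridCeil (T : ℝ≥0) (n : ℕ) (r : ℝ) : ℝ := ⌈r * (n + 1) / T⌉₊ * T / (n + 1)

lemma abs_gridCeil_sub_le (hT : 0 < T) (n : ℕ) {r : ℝ} (hr : 0 ≤ r) :
    |gridCeil T n r - r| ≤ T / (n + 1) := by
  have hT' : (0 : ℝ) < T := hT
  have hn : (0 : ℝ) < n + 1 := by positivity
  have h0 : (0 : ℝ) ≤ r * (n + 1) / T := by positivity
  have h1 : r * (n + 1) / T ≤ ⌈r * (n + 1) / T⌉₊ := Nat.le_ceil _
  have h2 : (⌈r * (n + 1) / T⌉₊ : ℝ) < r * (n + 1) / T + 1 := Nat.ceil_lt_add_one h0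
  unfold gridCeil
  set k := ⌈r * (n + 1) / T⌉₊
  rw [div_le_iff₀ hT'] at h1
  rw [← sub_lt_iff_lt_add, lt_div_iff₀ hT'] at h2
  rw [abs_le]
  constructor
  · rw [neg_le_sub_iff_le_add, ← add_div, le_div_iff₀ hn]
    linarith
  · rw [sub_le_iff_le_add, div_le_iff₀ hn, add_mul, div_mul_cancel₀ _ hn.ne']
    linarith

lemma gridCeil_self (hT : 0 < T) (n : ℕ) : gridCeil T n T = T := by
  have hT' : (T : ℝ) ≠ 0 := (NNReal.coe_pos.2 hT).ne'
  have h : (T : ℝ) * (n + 1) / T = ((n + 1 : ℕ) : ℝ) := by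
    push_cast
    field_simp
  rw [gridCeil, h, Nat.ceil_natCast]
  push_cast
  field_simp

/-- Floor and ceiling are adjoint to the inclusion of the integers: sampling a path at the left ends
of the cells delays a jump at `r` to `gridCeil T n r`. -/
lemma le_gridPoint_gridIndex_iff (hT : 0 < T) (n : ℕ) (r : ℝ) (t : TimeInterval T) :
    r ≤ ((gridPoint T n (gridIndex n t) : ℝ≥0) : ℝ) ↔ gridCeil T n r ≤ t := by
  have hT' : (0 : ℝ) < T := hT
  have hn : (0 : ℝ) < n + 1 := by positivity
  have h0 : (0 : ℝ) ≤ ((t : ℝ≥0) : ℝ) * (n + 1) / T := by positivity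
  rw [gridPoint_gridIndex, le_div_iff₀ hn, ← div_le_iff₀ hT', ← Nat.ceil_le, gridIndex,
    Nat.le_floor_iff h0, le_div_iff₀ hT', ← div_le_iff₀ hn, gridCeil]

lemma OrderIso.timeInterval_apply_last (ρ : TimeInterval T ≃o TimeInterval T) (t : TimeInterval T)
    (ht : (t : ℝ≥0) = T) : (ρ t : ℝ≥0) = T := by
  refine le_antisymm (ρ t).2.2 ?_
  have h : ρ.symm ⟨T, zero_le, le_rfl⟩ ≤ t :=
    (ρ.symm ⟨T, zero_le, le_rfl⟩).2.2.trans_eq ht.symm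
  exact (ρ.symm_apply_le).1 h

/-- A continuous function times a function of a right-continuous counting function is the limit of
its discretizations in the Skorohod distance. -/
lemma tendsto_skorohodDist_gridApprox (hT : 0 < T) {c : TimeInterval T → ℝ} (hc : Continuous c)
    {f : ℝ≥0 → ℕ} (hf : Monotone f) (hfc : ∀ t, ContinuousWithinAt f (Set.Ici t) t)
    (hf0 : f 0 = 0) (A : ℕ → ℝ) {x : TimeInterval T → ℝ} (hx : ∀ t, x t = c t * A (f t)) :
    Tendsto (fun n => skorohodDist x (gridApprox n x)) atTop (𝓝 0) := by
  have hjump : ∀ k, ∃ r : ℝ≥0, k ≤ f T → ∀ t, k ≤ f t ↔ r ≤ t := fun k => by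
    by_cases hk : k ≤ f T
    · obtain ⟨r, hr⟩ := exists_forall_le_iff_le hf hfc hk
      exact ⟨r, fun _ => hr⟩
    · exact ⟨0, fun h => absurd h hk⟩
  choose r hr using hjump
  obtain ⟨M, hM⟩ : ∃ M, ∀ k ≤ f T, |A k| ≤ M := by
    refine ⟨∑ k ∈ Finset.range (f T + 1), |A k|, fun k hk => ?_⟩
    exact Finset.single_le_sum (f := fun k => |A k|) (fun _ _ => abs_nonneg _)
      (Finset.mem_range.2 (Nat.lt_succ_of_le hk))
  have hM0 : 0 ≤ M := (abs_nonneg _).trans (hM 0 (Nat.zero_le _))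
  have hmesh : Tendsto (fun n : ℕ => (T : ℝ) / (n + 1)) atTop (𝓝 0) :=
    by simpa [div_eq_mul_inv] using tendsto_one_div_add_atTop_nhds_zero_nat.const_mul (T : ℝ)
  rw [ENNReal.tendsto_nhds_zero]
  intro ε' hε'
  obtain ⟨ε, hε, hεε'⟩ : ∃ ε : ℝ, 0 < ε ∧ ENNReal.ofReal ε ≤ ε' := by
    obtain ⟨e, he, hee⟩ := ENNReal.lt_iff_exists_nnreal_btwn.1 hε'
    exact ⟨e, by simpa using he, by simpa using hee.le⟩
  obtain ⟨d, hd, hcd⟩ := Metric.uniformContinuous_iff.1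
    (CompactSpace.uniformContinuous_of_continuous hc) (ε / (M + 1)) (by positivity)
  -- Only interior jump times need to be moved. No jump occurs at `0` because `f 0 = 0`, and a jump
  -- at `T` stays put because `T` is a grid point and every time change fixes it.
  let S : Finset ℝ := ((Finset.range (f T + 1)).image fun k => ((r k : ℝ≥0) : ℝ)).filter
    fun p => 0 < p ∧ p < T
  obtain ⟨δ, hδ, hS⟩ := exists_orderIso_map_eq (T := T) S
    (fun p hp => (Finset.mem_filter.1 hp).2) (η := min ε (d / 3)) (by positivity)
  filter_upwards [hmesh.eventually_le_const hδ,
    hmesh.eventually_le_const (show 0 < d / 3 by positivity)] with n hn1 hn2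
  obtain ⟨ρ, hρ1, hρ2⟩ := hS (gridCeil T n) fun p hp =>
    (abs_gridCeil_sub_le hT n (Finset.mem_filter.1 hp).2.1.le).trans hn1
  -- The time change aligns the jumps of the discretization with those of `f`, so the counts agree
  -- exactly and only the continuous factor contributes an error.
  have hft (t : TimeInterval T) : f (gridPoint T n (gridIndex n (ρ t))) = f t := by
    refine eq_of_forall_le_iff fun k => ?_
    by_cases hkT : k ≤ f T
    · rcases Nat.eq_zero_or_pos k with rfl | hk0
      · simp
      have hr0 : 0 < r k := by
        by_contra! h
        have := (hr k hkT 0).2 h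
        omega
      have hrT : r k ≤ T := (hr k hkT T).1 hkT
      have hρr : ((ρ ⟨r k, zero_le, hrT⟩ : ℝ≥0) : ℝ) = gridCeil T n (r k) := by
        rcases hrT.lt_or_eq with hlt | heq
        · refine hρ1 ⟨r k, zero_le, hrT⟩ (Finset.mem_filter.2 ⟨?_, hr0, hlt⟩)
          exact Finset.mem_image_of_mem _ (Finset.mem_range.2 (Nat.lt_succ_of_le hkT))
        · rw [OrderIso.timeInterval_apply_last ρ _ heq, heq, gridCeil_self hT]
      rw [hr k hkT, hr k hkT, ← NNReal.coe_le_coe, le_gridPoint_gridIndex_iff hT, ← hρr,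
        NNReal.coe_le_coe, Subtype.coe_le_coe, ρ.le_iff_le]
      rfl
    · have h (t : TimeInterval T) : ¬ k ≤ f t := fun h => hkT (h.trans (hf t.2.2))
      simp only [h]
  refine (skorohodDist_le ρ (fun t => (hρ2 t).trans (min_le_left _ _)) fun t => ?_).trans hεε'
  have hdist : dist t (gridPoint T n (gridIndex n (ρ t))) < d := by
    have h1 := (hρ2 t).trans (min_le_right _ _)
    have h2 := (abs_gridPoint_gridIndex_sub_le hT n (ρ t)).trans hn2
    rw [abs_le] at h1 h2
    rw [Subtype.dist_eq, NNReal.dist_eq, abs_lt]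
    constructor <;> linarith
  have h1 := hcd hdist
  rw [Real.dist_eq] at h1
  rw [gridApprox, hx, hx, hft, ← sub_mul, abs_mul]
  calc _ ≤ ε / (M + 1) * M := by
        gcongr
        exact hM _ (hf t.2.2)
    _ ≤ ε / (M + 1) * (M + 1) := by gcongr; linarith
    _ = ε := by field_simp

end GridApproximation

lemma ProbabilityTheory.iIndepFun.measure_iInter_pos {Ω ι : Type*} [MeasurableSpace Ω]
    {P : Measure Ω} {E : ι → Type*} [∀ i, MeasurableSpace (E i)] {f : ∀ i, Ω → E i}
    (hf : iIndepFun f P) (s : Finset ι) {S : ∀ i, Set (E i)} (hS : ∀ i ∈ s, MeasurableSet (S i))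
    (hpos : ∀ i ∈ s, 0 < P (f i ⁻¹' S i)) : 0 < P {ω | ∀ i ∈ s, f i ω ∈ S i} := by
  have h : {ω | ∀ i ∈ s, f i ω ∈ S i} = ⋂ i ∈ s, f i ⁻¹' S i := by ext; simp
  rw [h, hf.measure_inter_preimage_eq_mul s (fun i hi => hS i hi), pos_iff_ne_zero,
    Finset.prod_ne_zero_iff]
  exact fun i hi => (hpos i hi).ne'

/-! ### Small balls of Brownian motion -/

section BrownianSmallBall

/-- The linear interpolation of `f` along the grid `{k / (n + 1)}`. -/
noncomputable def gridInterp (n : ℕ) (f : ℝ≥0 → ℝ) (t : ℝ≥0) : ℝ :=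
  (1 - ((t : ℝ) * (n + 1) - ⌊t * (n + 1)⌋₊)) * f (⌊t * (n + 1)⌋₊ / (n + 1)) +
    ((t : ℝ) * (n + 1) - ⌊t * (n + 1)⌋₊) * f ((⌊t * (n + 1)⌋₊ + 1) / (n + 1))

lemma gridInterp_weight_mem (n : ℕ) (t : ℝ≥0) :
    (t : ℝ) * (n + 1) - ⌊t * (n + 1)⌋₊ ∈ Set.Icc (0 : ℝ) 1 := by
  have h1 : (⌊t * (n + 1)⌋₊ : ℝ≥0) ≤ t * (n + 1) := Nat.floor_le zero_le
  have h2 : t * (n + 1) < (⌊t * (n + 1)⌋₊ : ℝ≥0) + 1 := Nat.lt_floor_add_one _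
  rw [← NNReal.coe_le_coe] at h1
  rw [← NNReal.coe_lt_coe] at h2
  push_cast at h1 h2
  constructor <;> linarith

lemma gridInterp_sub (n : ℕ) (f g : ℝ≥0 → ℝ) (t : ℝ≥0) :
    gridInterp n (fun s => f s - g s) t = gridInterp n f t - gridInterp n g t := by
  simp only [gridInterp]
  ring

lemma gridInterp_const (n : ℕ) (c : ℝ) (t : ℝ≥0) : gridInterp n (fun _ => c) t = c := by
  simp only [gridInterp]
  ring

lemma abs_gridInterp_le {n : ℕ} {f : ℝ≥0 → ℝ} {t : ℝ≥0} {ε : ℝ}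
    (h0 : |f (⌊t * (n + 1)⌋₊ / (n + 1))| ≤ ε) (h1 : |f ((⌊t * (n + 1)⌋₊ + 1) / (n + 1))| ≤ ε) :
    |gridInterp n f t| ≤ ε := by
  obtain ⟨hw0, hw1⟩ := gridInterp_weight_mem n t
  unfold gridInterp
  set w := (t : ℝ) * (n + 1) - ⌊t * (n + 1)⌋₊
  refine (abs_add_le _ _).trans ?_
  rw [abs_mul, abs_mul, abs_of_nonneg hw0, abs_of_nonneg (sub_nonneg.2 hw1)]
  nlinarith

lemma eventually_abs_sub_gridInterp_le {f : ℝ≥0 → ℝ} (hf : Continuous f) (T : ℝ≥0) {ε : ℝ}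
    (hε : 0 < ε) : ∀ᶠ n in atTop, ∀ t ≤ T, |f t - gridInterp n f t| ≤ ε := by
  -- The interval reaches `T + 1` because the right end of the cell containing `t ≤ T` may exceed
  -- `T`.
  have huc := (isCompact_Icc (a := (0 : ℝ≥0)) (b := T + 1)).uniformContinuousOn_of_continuous
    hf.continuousOn
  obtain ⟨d, hd, hfd⟩ := Metric.uniformContinuousOn_iff.1 huc ε hε
  filter_upwards [(tendsto_one_div_add_atTop_nhds_zero_nat (𝕜 := ℝ)).eventually_lt_const hd]
    with n hn t ht
  have hn0 : (0 : ℝ) < n + 1 := by positivity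
  obtain ⟨hw0, hw1⟩ := gridInterp_weight_mem n t
  have key (s : ℝ≥0) (hs : |(s : ℝ) - t| ≤ 1 / (n + 1)) : |f t - f s| ≤ ε := by
    have h1 : (1 : ℝ) / (n + 1) ≤ 1 := by
      rw [div_le_one hn0]
      linarith [(n.cast_nonneg : (0 : ℝ) ≤ n)]
    have hsT : s ≤ T + 1 := by
      rw [← NNReal.coe_le_coe] at ht ⊢
      push_cast
      have := (abs_le.1 hs).2
      linarith
    have := hfd t ⟨zero_le, ht.trans (by simp)⟩ s ⟨zero_le, hsT⟩ (by
      rw [dist_comm, NNReal.dist_eq]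
      exact hs.trans_lt hn)
    rw [Real.dist_eq] at this
    exact this.le
  -- Interpolation is linear and reproduces constants, so the error at `t` is an average of two
  -- oscillations of `f`.
  have hrw : f t - gridInterp n f t = gridInterp n (fun s => f t - f s) t := by
    rw [gridInterp_sub, gridInterp_const]
  rw [hrw]
  refine abs_gridInterp_le (key _ ?_) (key _ ?_)
  · push_cast
    rw [abs_le, neg_le_sub_iff_le_add, ← add_div, le_div_iff₀ hn0, sub_le_iff_le_add,
      div_le_iff₀ hn0, add_mul, div_mul_cancel₀ _ hn0.ne']
    constructor <;> linarith
  · push_cast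
    rw [abs_le, neg_le_sub_iff_le_add, ← add_div, le_div_iff₀ hn0, sub_le_iff_le_add,
      div_le_iff₀ hn0, add_mul, div_mul_cancel₀ _ hn0.ne']
    constructor <;> linarith

variable {Ω : Type*} [MeasurableSpace Ω] {P : Measure Ω} {W : ℝ≥0 → Ω → ℝ}

lemma covariance_sub_add_const_mul (hW : IsPreBrownianReal W P) (a b : ℝ) (t x y z : ℝ≥0) :
    cov[fun ω => W t ω - (a * W x ω + b * W y ω), W z; P] =
      (min t z : ℝ≥0) - (a * (min x z : ℝ≥0) + b * (min y z : ℝ≥0)) := by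
  have := hW.isGaussianProcess.isProbabilityMeasure
  have hL (s : ℝ≥0) : MemLp (W s) 2 P :=
    (hW.isGaussianProcess.hasGaussianLaw_eval s).memLp_two
  have h1 : MemLp (fun ω => a * W x ω) 2 P := (hL x).const_mul a
  have h2 : MemLp (fun ω => b * W y ω) 2 P := (hL y).const_mul b
  have h3 : MemLp (fun ω => a * W x ω + b * W y ω) 2 P := h1.add h2
  have h4 : cov[fun ω => a * W x ω + b * W y ω, W z; P] =
      cov[fun ω => a * W x ω, W z; P] + cov[fun ω => b * W y ω, W z; P] :=
    covariance_add_left h1 h2 (hL z)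
  rw [covariance_fun_sub_left (hL t) h3 (hL z), h4,
    covariance_const_mul_left, covariance_const_mul_left]
  simp only [hW.covariance_eval, NNReal.coe_min]

/-- For a grid point `v`, the function `s ↦ min s v` is affine on every cell, since its only kink is
at `v`; it therefore equals its own interpolation. For the jointly Gaussian family, zero covariance
gives independence. -/
lemma covariance_sub_gridInterp_eq_zero (hW : IsPreBrownianReal W P) (n j : ℕ) (t : ℝ≥0) :
    cov[fun ω => W t ω - gridInterp n (fun s => W s ω) t, W (j / (n + 1)); P] = 0 := by
  have hn0' : (0 : ℝ≥0) < n + 1 := by positivity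
  simp only [gridInterp]
  rw [covariance_sub_add_const_mul hW]
  have h1 : (⌊t * (n + 1)⌋₊ : ℝ≥0) / (n + 1) ≤ t := by
    rw [div_le_iff₀ hn0']
    exact Nat.floor_le zero_le
  have h2 : t ≤ ((⌊t * (n + 1)⌋₊ : ℝ≥0) + 1) / (n + 1) := by
    rw [le_div_iff₀ hn0']
    exact (Nat.lt_floor_add_one _).le
  rcases le_or_gt j ⌊t * (n + 1)⌋₊ with hj | hj
  · have h3 : (j : ℝ≥0) / (n + 1) ≤ (⌊t * (n + 1)⌋₊ : ℝ≥0) / (n + 1) := by gcongr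
    rw [min_eq_right h3, min_eq_right (h3.trans h1), min_eq_right ((h3.trans h1).trans h2)]
    ring
  · have h3 : ((⌊t * (n + 1)⌋₊ : ℝ≥0) + 1) / (n + 1) ≤ (j : ℝ≥0) / (n + 1) := by
      gcongr
      exact_mod_cast hj
    rw [min_eq_left h3, min_eq_left (h2.trans h3), min_eq_left ((h1.trans h2).trans h3)]
    push_cast
    field_simp
    ring

/-- The deviation of a Brownian motion from its linear interpolation along a grid is independent
of the values on the grid. -/
lemma indepFun_sub_gridInterp (hW : IsPreBrownianReal W P) (n : ℕ) :
    IndepFun (fun ω (t : ℝ≥0) => W t ω - gridInterp n (fun s => W s ω) t)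
      (fun ω (j : ℕ) => W (j / (n + 1)) ω) P := by
  classical
  have mW (t : ℝ≥0) := hW.aemeasurable t
  refine IsGaussianProcess.indepFun_of_covariance_eq_zero
    (X := fun t ω => W t ω - gridInterp n (fun s => W s ω) t) ?_ (fun t => ?_) (fun j => mW _)
    (fun t j => covariance_sub_gridInterp_eq_zero hW n j t)
  · refine hW.isGaussianProcess.of_isGaussianProcess ?_
    rintro (t | j)
    · let a : ℝ≥0 := ⌊t * (n + 1)⌋₊ / (n + 1)
      let b : ℝ≥0 := (⌊t * (n + 1)⌋₊ + 1) / (n + 1)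
      let w : ℝ := (t : ℝ) * (n + 1) - ⌊t * (n + 1)⌋₊
      let I : Finset ℝ≥0 := {t, a, b}
      exact ⟨I, ContinuousLinearMap.proj (R := ℝ) (φ := fun _ : I => ℝ) ⟨t, by simp [I]⟩ -
        ((1 - w) • ContinuousLinearMap.proj (R := ℝ) (φ := fun _ : I => ℝ) ⟨a, by simp [I]⟩ +
          w • ContinuousLinearMap.proj (R := ℝ) (φ := fun _ : I => ℝ) ⟨b, by simp [I]⟩),
        fun ω => by simp [gridInterp, a, b, w]⟩
    · exact ⟨{(j : ℝ≥0) / (n + 1)}, ContinuousLinearMap.proj (R := ℝ)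
        (φ := fun _ : ({(j : ℝ≥0) / (n + 1)} : Finset ℝ≥0) => ℝ) ⟨_, Finset.mem_singleton_self _⟩,
        fun ω => by simp⟩
  · simp only [gridInterp]
    fun_prop

lemma measure_abs_increment_sub_le_pos (hW : IsPreBrownianReal W P) {s t : ℝ≥0} (hst : s ≠ t)
    (c : ℝ) {ε : ℝ} (hε : 0 < ε) :
    0 < P ((fun ω => W t ω - W s ω) ⁻¹' Metric.closedBall c ε) := by
  have h := (hW.hasLaw_sub t s).measure_eq (p := fun x => x ∈ Metric.closedBall c ε)
    Metric.isClosed_closedBall.measurableSet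
  have h' : P ((fun ω => W t ω - W s ω) ⁻¹' Metric.closedBall c ε) =
    gaussianReal 0 (nndist t.1 s.1) (Metric.closedBall c ε) := h
  have hv : nndist t.1 s.1 ≠ 0 := by
    rw [Ne, nndist_eq_zero]
    exact fun h => hst (NNReal.eq h.symm)
  rw [h', pos_iff_ne_zero]
  intro h0
  exact (Metric.measure_closedBall_pos volume c hε).ne' (gaussianReal_absolutelyContinuous' 0 hv h0)

/-- Each increment falls within `ε / (K + 1)` of that of `g` with positive probability,
independently over the cells. The errors add up to at most `ε` after `K` cells. -/
lemma measure_grid_close_pos (hW : IsPreBrownianReal W P) {g : ℝ≥0 → ℝ} (hg0 : g 0 = 0)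
    (n K : ℕ) {ε : ℝ} (hε : 0 < ε) :
    0 < P {ω | ∀ j ≤ K, |W (j / (n + 1)) ω - g (j / (n + 1))| ≤ ε} := by
  have hn0' : (0 : ℝ≥0) < n + 1 := by positivity
  let u : ℕ → ℝ≥0 := fun j => j / (n + 1)
  have hu : Monotone u := fun i j hij => by
    simp only [u]
    gcongr
  have hpos := (hW.hasIndepIncrements.nat hu).measure_iInter_pos (Finset.range K)
    (S := fun j => Metric.closedBall (g (u (j + 1)) - g (u j)) (ε / (K + 1)))
    (fun _ _ => Metric.isClosed_closedBall.measurableSet) (fun j _ => by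
      refine measure_abs_increment_sub_le_pos hW ?_ _ (by positivity)
      simp only [u, Ne, div_left_inj' hn0'.ne']
      norm_cast
      omega)
  refine hpos.trans_le (measure_mono_ae ?_)
  filter_upwards [hW.eval_zero_ae_eq_zero] with ω h0 h j hj
  have key : ∀ j ≤ K, |W (u j) ω - g (u j)| ≤ j * (ε / (K + 1)) := by
    intro j
    induction j with
    | zero => intro _; simp [u, h0, hg0]
    | succ j ih =>
      intro hj
      have h1 := ih (by omega)
      have h2 := h j (Finset.mem_range.2 (by omega))
      rw [Metric.mem_closedBall, Real.dist_eq] at h2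
      rw [abs_le] at h1 h2 ⊢
      push_cast
      constructor <;> linarith
  refine (key j hj).trans ?_
  rw [← mul_div_assoc, div_le_iff₀ (by positivity), mul_comm]
  gcongr
  have : (j : ℝ) ≤ K := by exact_mod_cast hj
  linarith

/-- **Small balls of Brownian motion**: a Brownian motion stays with positive probability uniformly
close on `[0, T]` to a given continuous function starting at `0`. -/
lemma measure_brownian_close_pos (hW : IsBrownianReal W P) {T : ℝ≥0} {g : ℝ≥0 → ℝ}
    (hg : Continuous g) (hg0 : g 0 = 0) {ε : ℝ} (hε : 0 < ε) {D : Set ℝ≥0} (hD : D.Countable)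
    (hDT : ∀ t ∈ D, t ≤ T) : 0 < P {ω | ∀ t ∈ D, |W t ω - g t| ≤ ε} := by
  have hprob := hW.isGaussianProcess.isProbabilityMeasure
  obtain ⟨n, hn, hgn⟩ : ∃ n, 0 < P {ω | ∀ t ∈ D, |W t ω - gridInterp n (fun s => W s ω) t| ≤ ε / 3} ∧
      ∀ t ≤ T, |g t - gridInterp n g t| ≤ ε / 3 := by
    have hev := eventually_abs_sub_gridInterp_le hg T (show 0 < ε / 3 by positivity)
    obtain ⟨n₀, hn₀⟩ := eventually_atTop.1 hev
    -- Otherwise the deviation event is null for every `n ≥ n₀`, although path continuity makes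
    -- these countably many events cover almost every `ω`.
    by_contra! hcon
    have hnull : P (⋃ n, ⋃ _ : n₀ ≤ n,
        {ω | ∀ t ∈ D, |W t ω - gridInterp n (fun s => W s ω) t| ≤ ε / 3}) = 0 := by
      refine measure_iUnion_null fun n => measure_iUnion_null fun hn => ?_
      by_contra h0
      obtain ⟨t, ht, hlt⟩ := hcon n (pos_iff_ne_zero.2 h0)
      exact (hn₀ n hn t ht).not_gt hlt
    have hfull : ∀ᵐ ω ∂P, ω ∈ ⋃ n, ⋃ _ : n₀ ≤ n,
        {ω | ∀ t ∈ D, |W t ω - gridInterp n (fun s => W s ω) t| ≤ ε / 3} := by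
      filter_upwards [hW.cont] with ω hω
      obtain ⟨n, h, hnn⟩ := ((eventually_abs_sub_gridInterp_le hω T
        (show 0 < ε / 3 by positivity)).and (eventually_ge_atTop n₀)).exists
      simp only [Set.mem_iUnion]
      exact ⟨n, hnn, fun t ht => h t (hDT t ht)⟩
    have hbad := (measure_eq_zero_iff_ae_notMem.1 hnull).and hfull
    exact absurd (hbad.mono fun ω h => h.1 h.2).exists (by simp)
  -- The extra `1` includes the right end of the cell containing `T`.
  let K := ⌊T * (n + 1)⌋₊ + 1
  have hgrid := measure_grid_close_pos hW.toIsPreBrownianReal hg0 n K (show 0 < ε / 3 by positivity)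
  have hind := (indepFun_sub_gridInterp hW.toIsPreBrownianReal n).measure_inter_preimage_eq_mul
    {y | ∀ t ∈ D, |y t| ≤ ε / 3} {v | ∀ j ≤ K, |v j - g (j / (n + 1))| ≤ ε / 3}
    (by
      have : {y : ℝ≥0 → ℝ | ∀ t ∈ D, |y t| ≤ ε / 3} = ⋂ t ∈ D, {y | |y t| ≤ ε / 3} := by ext; simp
      rw [this]
      exact MeasurableSet.biInter hD fun t _ => measurableSet_le (by fun_prop) (by fun_prop))
    (by
      have : {v : ℕ → ℝ | ∀ j ≤ K, |v j - g (j / (n + 1))| ≤ ε / 3} =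
        ⋂ j, ⋂ _ : j ≤ K, {v | |v j - g (j / (n + 1))| ≤ ε / 3} := by ext; simp
      rw [this]
      exact MeasurableSet.iInter fun j => MeasurableSet.iInter fun _ =>
        measurableSet_le (by fun_prop) (by fun_prop))
  refine (ENNReal.mul_pos hn.ne' hgrid.ne').trans_le (hind.symm.le.trans (measure_mono ?_))
  rintro ω ⟨h1, h2⟩ t ht
  have h1 : |W t ω - gridInterp n (fun s => W s ω) t| ≤ ε / 3 := h1 t ht
  have h2 : ∀ j ≤ K, |W (j / (n + 1)) ω - g (j / (n + 1))| ≤ ε / 3 := h2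
  have h3 := hgn t (hDT t ht)
  have hk : ⌊t * (n + 1)⌋₊ ≤ ⌊T * (n + 1)⌋₊ := Nat.floor_le_floor (by gcongr; exact hDT t ht)
  have h4 : |gridInterp n (fun s => W s ω - g s) t| ≤ ε / 3 := by
    refine abs_gridInterp_le (h2 _ (by omega)) ?_
    have := h2 (⌊t * (n + 1)⌋₊ + 1) (by omega)
    push_cast at this
    exact this
  rw [gridInterp_sub] at h4
  -- `W - g` splits into the deviation of `W`, the interpolation of `W - g`, and minus the deviation
  -- of `g`, each at most `ε / 3`.
  rw [abs_le] at *
  constructor <;> linarith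

end BrownianSmallBall

/-! ### Measurability for the jump-diffusion -/

section Measurability

variable {Ω : Type*} [MeasurableSpace Ω] {P : Measure Ω} {W : ℝ≥0 → Ω → ℝ} {N : ℝ≥0 → Ω → ℕ}
  {X : ℕ → Ω → ℝ} {lam : ℝ≥0}

lemma IsPoissonProcess.aemeasurable (hN : IsPoissonProcess N lam P) (t : ℝ≥0) :
    AEMeasurable (N t) P := by
  refine (hN.law_increments 0 t).aemeasurable.congr ?_
  filter_upwards [hN.zero] with ω h0
  simp [h0]

lemma aemeasurable_expJumpDiffusion (hW : ∀ t, AEMeasurable (W t) P)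
    (hN : ∀ t, AEMeasurable (N t) P) (hX : ∀ i, AEMeasurable (X i) P) {T : ℝ≥0} (x₀ μ σ : ℝ)
    (t : TimeInterval T) : AEMeasurable (fun ω => expJumpDiffusion T x₀ μ σ W N X ω t) P := by
  have hprod : Measurable fun p : ℕ × (ℕ → ℝ) => ∏ i ∈ Finset.range p.1, (1 + p.2 i) :=
    measurable_from_prod_countable_right fun k =>
      Finset.measurable_prod (Finset.range k) fun i _ => by fun_prop
  have h := hprod.comp_aemeasurable ((hN t).prodMk (aemeasurable_pi_lambda _ hX))
  have hWt := hW t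
  exact AEMeasurable.mul (by fun_prop) h

lemma aemeasurable_skorohodDist_expJumpDiffusion {T : ℝ≥0} (hT : 0 < T) (x₀ μ σ : ℝ)
    (hW : IsBrownianReal W P) (hN : IsPoissonProcess N lam P) (hX : ∀ i, AEMeasurable (X i) P)
    (x : TimeInterval T → ℝ) :
    AEMeasurable (fun ω => skorohodDist (expJumpDiffusion T x₀ μ σ W N X ω) x) P := by
  refine aemeasurable_skorohodDist
    (aemeasurable_expJumpDiffusion hW.aemeasurable hN.aemeasurable hX x₀ μ σ) ?_ x
  filter_upwards [hW.cont, hN.zero, hN.paths] with ω hWω h0 hNω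
  exact tendsto_skorohodDist_gridApprox hT
    (c := fun t => x₀ * Real.exp ((μ - σ ^ 2 / 2) * (t : ℝ) + σ * W t ω)) (by fun_prop)
    hNω.1 hNω.2 h0 (fun k => ∏ i ∈ Finset.range k, (1 + X i ω)) fun t => rfl

end Measurability

/-! ### Counting paths and their jump times -/

section Counting

variable {m : ℕ}

/-- The number of `i` with `s i ≤ t`. -/
noncomputable def countLE (s : Fin m → ℝ≥0) (t : ℝ≥0) : ℕ := (Finset.univ.filter fun i => s i ≤ t).card

lemma countLE_mono (s : Fin m → ℝ≥0) : Monotone (countLE s) := fun _ _ h =>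
  Finset.card_le_card (Finset.monotone_filter_right _ fun _ _ hi => hi.trans h)

lemma countLE_le (s : Fin m → ℝ≥0) (t : ℝ≥0) : countLE s t ≤ m := by
  simpa [countLE] using Finset.card_filter_le (Finset.univ : Finset (Fin m)) fun i => s i ≤ t

lemma succ_le_countLE_iff {s : Fin m → ℝ≥0} (hs : StrictMono s) (i : Fin m) (t : ℝ≥0) :
    (i : ℕ) + 1 ≤ countLE s t ↔ s i ≤ t := by
  constructor
  · intro h
    by_contra! hlt
    have hsub : (Finset.univ.filter fun j => s j ≤ t) ⊆ Finset.Iio i := fun j hj =>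
      Finset.mem_Iio.2 (hs.lt_iff_lt.1 ((Finset.mem_filter.1 hj).2.trans_lt hlt))
    have := Finset.card_le_card hsub
    rw [Fin.card_Iio] at this
    unfold countLE at h
    omega
  · intro h
    have hsub : Finset.Iic i ⊆ Finset.univ.filter fun j => s j ≤ t := fun j hj =>
      Finset.mem_filter.2 ⟨Finset.mem_univ _, (hs.monotone (Finset.mem_Iic.1 hj)).trans h⟩
    have := Finset.card_le_card hsub
    rwa [Fin.card_Iic] at this

/-- The first grid point at or after `r` lies within one mesh of `r` and, by assumption, is not
before `s`. -/
lemma le_add_of_grid_le {T : ℝ≥0} (hT : 0 < T) {n : ℕ} {r s : ℝ≥0} (hr : r ≤ T)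
    (h : ∀ j ≤ n + 1, r ≤ j * T / (n + 1) → s ≤ j * T / (n + 1)) :
    (s : ℝ) ≤ r + T / (n + 1) := by
  have hT' : (0 : ℝ) < T := hT
  have hn : (0 : ℝ) < n + 1 := by positivity
  have hk : ⌈(r : ℝ) * (n + 1) / T⌉₊ ≤ n + 1 := by
    refine Nat.ceil_le.2 ?_
    rw [div_le_iff₀ hT', mul_comm]
    push_cast
    gcongr
  have h1 : r ≤ (⌈(r : ℝ) * (n + 1) / T⌉₊ : ℝ≥0) * T / (n + 1) := by
    rw [← NNReal.coe_le_coe]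
    push_cast
    rw [le_div_iff₀ hn, ← div_le_iff₀ hT']
    exact Nat.le_ceil _
  have h2 := h _ hk h1
  rw [← NNReal.coe_le_coe] at h2
  push_cast at h2
  have h3 := (abs_le.1 (abs_gridCeil_sub_le hT n r.2)).2
  unfold gridCeil at h3
  linarith [show (⌈(r : ℝ) * (n + 1) / T⌉₊ : ℝ) * T / (n + 1) - r ≤ T / (n + 1) from h3]

/-- If two counting functions agree on a fine grid, then a time change close to the identity
transforms one into the other. -/
lemma eventually_exists_orderIso_counting {T : ℝ≥0} (hT : 0 < T) {s : Fin m → ℝ≥0}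
    (hs : StrictMono s) (hsT : ∀ i, 0 < s i ∧ s i < T) {η : ℝ} (hη : 0 < η) :
    ∀ᶠ n : ℕ in atTop, ∀ f : ℝ≥0 → ℕ, Monotone f →
      (∀ t, ContinuousWithinAt f (Set.Ici t) t) →
      (∀ j : ℕ, j ≤ n + 1 → f (j * T / (n + 1)) = countLE s (j * T / (n + 1))) →
      ∃ ρ : TimeInterval T ≃o TimeInterval T, (∀ t : TimeInterval T, f (ρ t) = countLE s t) ∧
        ∀ t, |((ρ t : ℝ≥0) : ℝ) - t| ≤ η := by
  have hcountT : countLE s T = m := by simp [countLE, fun i => (hsT i).2.le]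
  have hmesh : Tendsto (fun n : ℕ => (T : ℝ) / (n + 1)) atTop (𝓝 0) := by
    simpa [div_eq_mul_inv] using tendsto_one_div_add_atTop_nhds_zero_nat.const_mul (T : ℝ)
  obtain ⟨δ, hδ, hS⟩ := exists_orderIso_map_eq (T := T)
    (Finset.univ.image fun i => ((s i : ℝ≥0) : ℝ)) (fun p hp => by
      obtain ⟨i, -, rfl⟩ := Finset.mem_image.1 hp
      exact ⟨(hsT i).1, (hsT i).2⟩) hη
  filter_upwards [hmesh.eventually_le_const hδ] with n hn f hf hfc hfs
  have hfT : f T = m := by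
    have h := hfs (n + 1) le_rfl
    have hTT : ((n + 1 : ℕ) : ℝ≥0) * T / (n + 1) = T := by
      push_cast
      field_simp
    rwa [hTT, hcountT] at h
  have hr (i : Fin m) : ∃ r, ∀ t, (i : ℕ) + 1 ≤ f t ↔ r ≤ t :=
    exists_forall_le_iff_le hf hfc (T := T) (by omega)
  choose r hr using hr
  have hrT (i : Fin m) : r i ≤ T := (hr i T).1 (by omega)
  have hgrid (i : Fin m) (j : ℕ) (hj : j ≤ n + 1) :
      r i ≤ j * T / (n + 1) ↔ s i ≤ j * T / (n + 1) := by
    rw [← hr, ← succ_le_countLE_iff hs, hfs j hj]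
  have hrs (i : Fin m) : |(r i : ℝ) - s i| ≤ δ := by
    have h1 := le_add_of_grid_le hT (hrT i) fun j hj => (hgrid i j hj).1
    have h2 := le_add_of_grid_le hT (hsT i).2.le fun j hj => (hgrid i j hj).2
    rw [abs_le]
    constructor <;> linarith
  have hinj : Function.Injective fun i => ((s i : ℝ≥0) : ℝ) :=
    NNReal.coe_injective.comp hs.injective
  -- The target map sends each `s i` to `r i`; its value `id` elsewhere plays no role.
  obtain ⟨ρ, hρ, hρη⟩ := hS (Function.extend (fun i => ((s i : ℝ≥0) : ℝ)) (fun i => (r i : ℝ)) id)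
    fun p hp => by
      obtain ⟨i, -, rfl⟩ := Finset.mem_image.1 hp
      rw [hinj.extend_apply]
      exact hrs i
  refine ⟨ρ, fun t => eq_of_forall_le_iff fun k => ?_, hρη⟩
  rcases Nat.eq_zero_or_pos k with rfl | hk
  · simp
  by_cases hkm : k ≤ m
  · obtain ⟨i, rfl⟩ : ∃ i : Fin m, k = i + 1 := ⟨⟨k - 1, by omega⟩, by simp; omega⟩
    have hρi : (ρ ⟨s i, zero_le, (hsT i).2.le⟩ : ℝ≥0) = r i := by
      refine NNReal.coe_injective ?_
      rw [hρ _ (Finset.mem_image_of_mem _ (Finset.mem_univ i))]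
      exact hinj.extend_apply _ _ i
    rw [hr, succ_le_countLE_iff hs, ← hρi, Subtype.coe_le_coe, ρ.le_iff_le]
    rfl
  · have h1 : ¬ k ≤ f (ρ t) := by
      have := hf (ρ t).2.2
      omega
    have h2 : ¬ k ≤ countLE s t := by
      have := countLE_le s t
      omega
    simp only [h1, h2]

end Counting

/-! ### Positive probability for the counts and jump sizes -/

section Positivity

variable {Ω : Type*} [MeasurableSpace Ω] {P : Measure Ω}

lemma measure_poisson_grid_pos {N : ℝ≥0 → Ω → ℕ} {lam : ℝ≥0} (hN : IsPoissonProcess N lam P)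
    (hlam : 0 < lam) {T : ℝ≥0} (hT : 0 < T) (n K : ℕ) (d : ℕ → ℕ) :
    0 < P {ω | ∀ j ∈ Finset.range K,
      N ((j + 1 : ℕ) * T / (n + 1)) ω - N (j * T / (n + 1)) ω = d j} := by
  have hu : Monotone fun j : ℕ => (j * T / (n + 1) : ℝ≥0) := fun i j hij => by
    dsimp only
    gcongr
  refine (hN.indep_increments.nat hu).measure_iInter_pos (Finset.range K) (S := fun j => {d j})
    (fun _ _ => measurableSet_singleton _) fun j _ => ?_
  have hlaw := hN.law_increments (j * T / (n + 1)) (T / (n + 1))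
  have hadd : (j * T / (n + 1) + T / (n + 1) : ℝ≥0) = (j + 1 : ℕ) * T / (n + 1) := by
    push_cast
    ring
  rw [hadd] at hlaw
  have h := hlaw.measure_eq (p := fun k => k ∈ ({d j} : Set ℕ)) (measurableSet_singleton _)
  have hpos : 0 < poissonMeasure (lam * (T / (n + 1))) {d j} := by
    rw [poissonMeasure_singleton, ENNReal.ofReal_pos]
    have : (0 : ℝ) < ((lam * (T / (n + 1)) : ℝ≥0) : ℝ) := by
      rw [NNReal.coe_pos]
      positivity
    positivity
  exact hpos.trans_eq h.symm

lemma measure_closedBall_pos_of_cdf {F : Measure ℝ} [IsProbabilityMeasure F] {a δ : ℝ}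
    (h : 0 < cdf F (a + δ) - cdf F (a - δ)) : 0 < F (Metric.closedBall a δ) := by
  have h1 : F (Set.Ioc (a - δ) (a + δ)) = ENNReal.ofReal (cdf F (a + δ) - cdf F (a - δ)) := by
    conv_lhs => rw [← measure_cdf F]
    exact StieltjesFunction.measure_Ioc _ _ _
  refine (ENNReal.ofReal_pos.2 h).trans_le (h1.symm.le.trans (measure_mono ?_))
  rw [Real.closedBall_eq_Icc]
  exact Set.Ioc_subset_Icc_self

lemma exists_abs_exp_mul_prod_sub_le (a : ℕ → ℝ) (m : ℕ) {η : ℝ} (hη : 0 < η) :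
    ∃ δ > 0, ∀ k ≤ m, ∀ (w : ℝ) (b : ℕ → ℝ), |w| ≤ δ → (∀ i < m, |b i - a i| ≤ δ) →
      |Real.exp w * ∏ i ∈ Finset.range k, (1 + b i) - ∏ i ∈ Finset.range k, (1 + a i)| ≤ η := by
  -- The products are written over `Fin m` so that continuity at `(0, a)` is a statement in a
  -- finite-dimensional space. One `δ` then serves the finitely many `k ≤ m`.
  have hk (k : ℕ) : ∀ᶠ p in 𝓝 ((0 : ℝ), fun i : Fin m => a i),
      k ≤ m → |Real.exp p.1 * ∏ i ∈ Finset.univ.filter (fun i : Fin m => (i : ℕ) < k), (1 + p.2 i) -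
        ∏ i ∈ Finset.univ.filter (fun i : Fin m => (i : ℕ) < k), (1 + a i)| < η := by
    have hprod : Continuous fun p : ℝ × (Fin m → ℝ) =>
        ∏ i ∈ Finset.univ.filter (fun i : Fin m => (i : ℕ) < k), (1 + p.2 i) :=
      continuous_finsetProd _ fun i _ => by fun_prop
    have hc : Continuous fun p : ℝ × (Fin m → ℝ) => |Real.exp p.1 *
        ∏ i ∈ Finset.univ.filter (fun i : Fin m => (i : ℕ) < k), (1 + p.2 i) -
        ∏ i ∈ Finset.univ.filter (fun i : Fin m => (i : ℕ) < k), (1 + a i)| := by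
      fun_prop
    filter_upwards [hc.continuousAt.eventually_lt_const (by simpa using hη)] with p hp _ using hp
  have hall := (Filter.eventually_all_finset (Finset.range (m + 1))).2 fun k _ => hk k
  obtain ⟨δ, hδ, hball⟩ := Metric.nhds_basis_closedBall.eventually_iff.1 hall
  refine ⟨δ, hδ, fun k hkm w b hw hb => ?_⟩
  have hmem : (w, fun i : Fin m => b i) ∈ Metric.closedBall ((0 : ℝ), fun i : Fin m => a i) δ := by
    rw [Metric.mem_closedBall, Prod.dist_eq, max_le_iff, dist_pi_le_iff hδ.le]
    exact ⟨by simpa using hw, fun i => hb i i.2⟩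
  have h := hball hmem k (Finset.mem_range.2 (by omega)) hkm
  have hprod (c : ℕ → ℝ) : ∏ i ∈ Finset.univ.filter (fun i : Fin m => (i : ℕ) < k), (1 + c i) =
      ∏ i ∈ Finset.range k, (1 + c i) := by
    rw [Finset.prod_filter, Fin.prod_univ_eq_prod_range (fun i => if i < k then 1 + c i else 1),
      ← Finset.prod_filter]
    congr 1
    ext i
    simp
    omega
  simp only [hprod] at h
  exact h.le

end Positivity

/-! ### The pathwise estimate and positivity of small balls -/

section SmallBall

/-- The pathwise estimate: if the Brownian part, the counting part and the jump sizes of a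
jump-diffusion path are close to those of a reference path, then the paths are close. -/
lemma exists_forall_skorohodDist_le {T : ℝ≥0} (hT : 0 < T) {x₀ σ : ℝ} (μ : ℝ) (hx₀ : 0 < x₀)
    (hσ : 0 < σ) {z : TimeInterval T → ℝ} (hz : Continuous z) {m : ℕ} {s : Fin m → ℝ≥0}
    (hs : StrictMono s) (hsT : ∀ i, 0 < s i ∧ s i < T) (a : ℕ → ℝ) {ε : ℝ} (hε : 0 < ε) :
    ∃ (n : ℕ) (δ : ℝ), 0 < δ ∧ ∀ (w : ℝ≥0 → ℝ) (f : ℝ≥0 → ℕ) (b : ℕ → ℝ),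
      (∀ t : TimeInterval T, |w t - (z t - (μ - σ ^ 2 / 2) / σ * (t : ℝ))| ≤ δ) →
      Monotone f → (∀ t, ContinuousWithinAt f (Set.Ici t) t) →
      (∀ j : ℕ, j ≤ n + 1 → f (j * T / (n + 1)) = countLE s (j * T / (n + 1))) →
      (∀ i < m, |b i - a i| ≤ δ) →
      skorohodDist (fun t : TimeInterval T => x₀ * Real.exp ((μ - σ ^ 2 / 2) * (t : ℝ) + σ * w t) *
          ∏ i ∈ Finset.range (f t), (1 + b i))
        (fun t => x₀ * Real.exp (σ * z t) * ∏ i ∈ Finset.range (countLE s t), (1 + a i)) ≤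
      ENNReal.ofReal ε := by
  obtain ⟨M, hM⟩ := isCompact_univ.exists_bound_of_continuousOn (f := fun t => Real.exp (σ * z t))
    (by fun_prop : Continuous fun t => Real.exp (σ * z t)).continuousOn
  have hM' (t : TimeInterval T) : Real.exp (σ * z t) ≤ |M| :=
    (le_abs_self _).trans ((hM t trivial).trans (le_abs_self _))
  obtain ⟨δ, hδ, hδa⟩ := exists_abs_exp_mul_prod_sub_le a m
    (η := ε / (x₀ * (|M| + 1))) (by positivity)
  obtain ⟨d, hd, hzd⟩ := Metric.uniformContinuous_iff.1
    (CompactSpace.uniformContinuous_of_continuous hz) (δ / (2 * σ)) (by positivity)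
  obtain ⟨n, hn⟩ := (eventually_exists_orderIso_counting hT hs hsT
    (η := min ε (d / 2)) (by positivity)).exists
  -- After multiplication by `σ`, half of the budget `δ` for the exponent goes to the error of `w`
  -- and half to the oscillation of `z` under the time change.
  refine ⟨n, min δ (δ / (2 * σ)), by positivity, fun w f b hw hf hfc hfs hb => ?_⟩
  obtain ⟨ρ, hρf, hρ⟩ := hn f hf hfc hfs
  rw [skorohodDist_comm]
  refine skorohodDist_le ρ (fun t => (hρ t).trans (min_le_left _ _)) fun t => ?_
  have hzt : |z (ρ t) - z t| ≤ δ / (2 * σ) := by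
    have h := hzd (a := ρ t) (b := t) (by
      rw [Subtype.dist_eq, NNReal.dist_eq]
      linarith [(hρ t).trans (min_le_right _ _)])
    rw [Real.dist_eq] at h
    exact h.le
  have hwt := (hw (ρ t)).trans (min_le_right _ _)
  -- `v` is the logarithm of the ratio of the two exponential factors; the drift cancels against the
  -- correction in the target of `w`.
  set v : ℝ := (μ - σ ^ 2 / 2) * ((ρ t : ℝ≥0) : ℝ) + σ * w (ρ t) - σ * z t with hv
  have hvδ : |v| ≤ δ := by
    have hv' : v = σ * ((w (ρ t) - (z (ρ t) - (μ - σ ^ 2 / 2) / σ * ((ρ t : ℝ≥0) : ℝ))) +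
        (z (ρ t) - z t)) := by
      rw [hv]
      field_simp
      ring
    rw [hv', abs_mul, abs_of_pos hσ]
    calc _ ≤ σ * (δ / (2 * σ) + δ / (2 * σ)) := by
          gcongr
          exact (abs_add_le _ _).trans (add_le_add hwt hzt)
      _ = δ := by field_simp; ring
  have key := hδa (countLE s t) (countLE_le s t) v b hvδ
    fun i hi => (hb i hi).trans (min_le_left _ _)
  rw [abs_sub_comm] at key
  have hexp : Real.exp ((μ - σ ^ 2 / 2) * ((ρ t : ℝ≥0) : ℝ) + σ * w (ρ t)) =
      Real.exp (σ * z t) * Real.exp v := by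
    rw [← Real.exp_add, hv]
    ring_nf
  rw [hρf, hexp, mul_assoc, mul_assoc, mul_assoc, ← mul_sub, ← mul_sub, abs_mul, abs_mul,
    abs_of_pos hx₀, abs_of_pos (Real.exp_pos _)]
  calc _ ≤ x₀ * ((|M| + 1) * (ε / (x₀ * (|M| + 1)))) := by
        gcongr
        exact (hM' t).trans (by linarith)
    _ = ε := by field_simp

variable {Ω : Type*} [MeasurableSpace Ω] {P : Measure Ω}

lemma ProbabilityTheory.IndepFun.measure_inter₃_pos {α β γ : Type*} [MeasurableSpace α]
    [MeasurableSpace β] [MeasurableSpace γ] {f : Ω → α} {g : Ω → β} {h : Ω → γ}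
    (hfg : IndepFun f g P) (hfgh : IndepFun (fun ω => (f ω, g ω)) h P) {A : Set α} {B : Set β}
    {C : Set γ} (hA : MeasurableSet A) (hB : MeasurableSet B) (hC : MeasurableSet C)
    (hA0 : 0 < P (f ⁻¹' A)) (hB0 : 0 < P (g ⁻¹' B)) (hC0 : 0 < P (h ⁻¹' C)) :
    0 < P (f ⁻¹' A ∩ g ⁻¹' B ∩ h ⁻¹' C) := by
  have h1 := hfg.measure_inter_preimage_eq_mul A B hA hB
  have h2 := hfgh.measure_inter_preimage_eq_mul (A ×ˢ B) C (hA.prod hB) hC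
  have h3 : (fun ω => (f ω, g ω)) ⁻¹' (A ×ˢ B) = f ⁻¹' A ∩ g ⁻¹' B := rfl
  rw [h3, h1] at h2
  rw [h2]
  exact ENNReal.mul_pos (ENNReal.mul_pos hA0.ne' hB0.ne').ne' hC0.ne'

/-- Both functions are monotone, so the truncated differences are true ones and can be summed from
the common value `0`. -/
lemma countLE_eq_of_increments {m : ℕ} {s : Fin m → ℝ≥0} (hs : ∀ i, 0 < s i) {f : ℝ≥0 → ℕ}
    (hf : Monotone f) (hf0 : f 0 = 0) {u : ℕ → ℝ≥0} (hu : Monotone u) (hu0 : u 0 = 0) {K : ℕ}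
    (h : ∀ j ∈ Finset.range K, f (u (j + 1)) - f (u j) = countLE s (u (j + 1)) - countLE s (u j))
    {j : ℕ} (hj : j ≤ K) : f (u j) = countLE s (u j) := by
  induction j with
  | zero => simp [hu0, hf0, countLE, fun i => (hs i).ne']
  | succ j ih =>
    have h1 := ih (by omega)
    have h2 := h j (Finset.mem_range.2 (by omega))
    have h3 := hf (hu j.le_succ)
    have h4 := countLE_mono s (hu j.le_succ)
    simp only [Nat.succ_eq_add_one] at h3 h4
    omega

lemma measure_skorohodDist_lt_pos {T : ℝ≥0} (hT : 0 < T) {x₀ σ : ℝ} (μ : ℝ) (hx₀ : 0 < x₀)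
    (hσ : 0 < σ) {W : ℝ≥0 → Ω → ℝ} (hW : IsBrownianReal W P) {lam : ℝ≥0} (hlam : 0 < lam)
    {N : ℝ≥0 → Ω → ℕ} (hN : IsPoissonProcess N lam P) {X : ℕ → Ω → ℝ} (hXindep : iIndepFun X P)
    (hWN : IndepFun (fun ω t => W t ω) (fun ω t => N t ω) P)
    (hWNX : IndepFun (fun ω => ((fun t => W t ω), (fun t => N t ω))) (fun ω i => X i ω) P)
    {z : TimeInterval T → ℝ} (hz : Continuous z)
    (hz0 : ∀ t : TimeInterval T, (t : ℝ≥0) = 0 → z t = 0) {m : ℕ} {s : Fin m → ℝ≥0}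
    (hs : StrictMono s) (hsT : ∀ i, 0 < s i ∧ s i < T) {a : ℕ → ℝ}
    (ha : ∀ i < m, ∀ δ > 0, 0 < P (X i ⁻¹' Metric.closedBall (a i) δ)) {ε : ℝ} (hε : 0 < ε) :
    0 < P {ω | skorohodDist (expJumpDiffusion T x₀ μ σ W N X ω)
      (fun t => x₀ * Real.exp (σ * z t) * ∏ i ∈ Finset.range (countLE s t), (1 + a i)) <
        ENNReal.ofReal ε} := by
  obtain ⟨n, δ, hδ, hclose⟩ := exists_forall_skorohodDist_le hT μ hx₀ hσ hz hs hsT a (half_pos hε)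
  -- `z` is extended by its value at `T`; subtracting the scaled drift makes `(μ - σ²/2) t + σ g t =
  -- σ z t` on `[0, T]`.
  let g : ℝ≥0 → ℝ := fun t => z (Set.projIcc 0 T zero_le t) - (μ - σ ^ 2 / 2) / σ * (t : ℝ)
  have hg : Continuous g := by fun_prop
  have hgz (t : TimeInterval T) : g t = z t - (μ - σ ^ 2 / 2) / σ * (t : ℝ) := by
    simp only [g, Set.projIcc_val]
  have hg0 : g 0 = 0 := by simp [g, hz0]
  have : Nonempty (TimeInterval T) := ⟨⟨0, le_rfl, zero_le⟩⟩
  -- The product σ-algebra on paths is suited to countably many times, so closeness is imposed on a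
  -- dense sequence and extended to `[0, T]` by path continuity.
  let D : Set ℝ≥0 := Set.range fun k => (TopologicalSpace.denseSeq (TimeInterval T) k : ℝ≥0)
  let u : ℕ → ℝ≥0 := fun j => j * T / (n + 1)
  have hu : Monotone u := fun i j hij => by
    dsimp only [u]
    gcongr
  let A : Set (ℝ≥0 → ℝ) := {y | ∀ t ∈ D, |y t - g t| ≤ δ}
  let B : Set (ℝ≥0 → ℕ) := {f | ∀ j ∈ Finset.range (n + 1),
    f (u (j + 1)) - f (u j) = countLE s (u (j + 1)) - countLE s (u j)}
  let C : Set (ℕ → ℝ) := {b | ∀ i ∈ Finset.range m, b i ∈ Metric.closedBall (a i) δ}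
  have hA : MeasurableSet A := by
    have : A = ⋂ t ∈ D, {y | |y t - g t| ≤ δ} := by ext; simp [A]
    rw [this]
    exact MeasurableSet.biInter (Set.countable_range _) fun t _ =>
      measurableSet_le (by fun_prop) (by fun_prop)
  have hB : MeasurableSet B := by
    have : B = ⋂ j ∈ Finset.range (n + 1), {f : ℝ≥0 → ℕ |
        f (u (j + 1)) - f (u j) = countLE s (u (j + 1)) - countLE s (u j)} := by ext; simp [B]
    rw [this]
    exact Finset.measurableSet_biInter _ fun j _ =>
      measurableSet_eq_fun (by fun_prop) (by fun_prop)
  have hC : MeasurableSet C := by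
    have : C = ⋂ i ∈ Finset.range m, {b : ℕ → ℝ | b i ∈ Metric.closedBall (a i) δ} := by
      ext; simp [C]
    rw [this]
    exact Finset.measurableSet_biInter _ fun i _ =>
      measurable_pi_apply i Metric.isClosed_closedBall.measurableSet
  have hpos := hWN.measure_inter₃_pos hWNX hA hB hC
    (measure_brownian_close_pos hW (T := T) hg hg0 hδ (Set.countable_range _)
      (by rintro - ⟨k, rfl⟩; exact (TopologicalSpace.denseSeq (TimeInterval T) k).2.2))
    (measure_poisson_grid_pos hN hlam hT n (n + 1)
      fun j => countLE s (u (j + 1)) - countLE s (u j))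
    (hXindep.measure_iInter_pos (Finset.range m) (S := fun i => Metric.closedBall (a i) δ)
      (fun _ _ => Metric.isClosed_closedBall.measurableSet)
      fun i hi => ha i (Finset.mem_range.1 hi) δ hδ)
  refine hpos.trans_le (measure_mono_ae ?_)
  filter_upwards [hW.cont, hN.zero, hN.paths] with ω hWω h0 hNω hω
  obtain ⟨⟨hωA, hωB⟩, hωC⟩ := hω
  have hωW (t : TimeInterval T) : |W t ω - g t| ≤ δ := by
    refine (TopologicalSpace.denseRange_denseSeq (TimeInterval T)).induction_on
      (p := fun t => |W t ω - g t| ≤ δ) t ?_ fun k => hωA _ (Set.mem_range_self k)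
    exact isClosed_le (by fun_prop) (by fun_prop)
  have hle := hclose (fun t => W t ω) (fun t => N t ω) (fun i => X i ω)
    (fun t => by rw [← hgz]; exact hωW t) hNω.1 hNω.2
    (fun j hj => countLE_eq_of_increments (fun i => (hsT i).1) hNω.1 h0 hu (by simp [u]) hωB hj)
    (fun i hi => hωC i (Finset.mem_range.2 hi))
  exact hle.trans_lt ((ENNReal.ofReal_lt_ofReal_iff hε).2 (half_lt_self hε))

end SmallBall

theorem mainTheorem8
    {Ω : Type*} [MeasurableSpace Ω] (P : Measure Ω) [IsProbabilityMeasure P]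
    (T : ℝ≥0) (hT : 0 < T) (𝒯 : PartitionSeq T)
    (x₀ μ σ : ℝ) (hx₀ : 0 < x₀) (hσ : 0 < σ)
    (C : Set ℝ) (hC : C.Nonempty) (hCb : BddBelow C) (hC1 : -1 < sInf C)
    (W : ℝ≥0 → Ω → ℝ) (hW : IsBrownianReal W P)
    (lam : ℝ≥0) (hlam : 0 < lam)
    (N : ℝ≥0 → Ω → ℕ) (hN : IsPoissonProcess N lam P)
    (X : ℕ → Ω → ℝ) (F : Measure ℝ) [IsProbabilityMeasure F]
    (hX : ∀ i, HasLaw (X i) F P) (hXindep : iIndepFun X P)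
    (hWN : IndepFun (fun ω t => W t ω) (fun ω t => N t ω) P)
    (hWNX : IndepFun (fun ω => ((fun t => W t ω), (fun t => N t ω))) (fun ω i => X i ω) P)
    (hA1 : ∀ a ∈ C, ∀ ε : ℝ, 0 < ε → 0 < cdf F (a + ε) - cdf F (a - ε)) :
    SmallBallProperty P skorohodDist (expJumpDiffusion T x₀ μ σ W N X)
      (JumpDiffusionPaths 𝒯 σ C x₀) := by
  rintro x ⟨z, ⟨hz, hz0, -⟩, m, n, a, ⟨s, hs, hsT, hn⟩, ha, hx⟩ ε hε
  have hx' : x = fun t => x₀ * Real.exp (σ * z t) *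
      ∏ i ∈ Finset.range (countLE s t), (1 + a i) := by
    funext t
    rw [hx, hn]
    rfl
  refine ⟨nullMeasurableSet_lt (aemeasurable_skorohodDist_expJumpDiffusion hT x₀ μ σ hW hN
    (fun i => (hX i).aemeasurable) x) aemeasurable_const, ?_⟩
  rw [hx']
  refine measure_skorohodDist_lt_pos hT μ hx₀ hσ hW hlam hN hXindep hWN hWNX hz hz0 hs hsT
    (fun i hi δ hδ => ?_) hε
  have h := (hX i).measure_eq (p := fun y => y ∈ Metric.closedBall (a i) δ)
    Metric.isClosed_closedBall.measurableSet
  exact (measure_closedBall_pos_of_cdf (hA1 (a i) (ha i hi) δ hδ)).trans_eq h.symm
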